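/- Let $\alpha=(\alpha_n)_{n\ge 1}$ be a positive, strictly increasing sequence of real numbers tending to infinity, and let $(s_k)_{k\ge 1}\subset(1,\infty)$ be strictly increasing with $s_k\to\infty$. Put $v_k(n):=s_k^{-\alpha_n}$, let $c_0(v_k)$ be the Banach space of all $x=(x_n)\in\mathbb C^{\mathbb N}$ with $v_k(n)x_n\to 0$ as $n\to\infty$, with norm $\sup_n v_k(n)|x_n|$, and let $E_\alpha:=\operatorname{ind}_k c_0(v_k)$ be the union $\bigcup_k c_0(v_k)$ endowed with the finest locally convex Hausdorff topology for which all inclusions $c_0(v_k)\hookrightarrow E_\alpha$ are continuous. Then the Cesàro operator $\mathsf C x:=\big(\tfrac{x_1+\dots+x_n}{n}\big)_{n\ge 1}$ is a continuous linear operator from $E_\alpha$ into itself, and the following hold. 1. $\mathsf C$ is power bounded, i.e. $\{\mathsf C^m: m\ge 1\}$ is an equicontinuous set of operators on $E_\alpha$. 2. $\mathsf C$ is uniformly mean ergodic, i.e. the averages $\frac1n\sum_{m=1}^n \mathsf C^m$ converge, as $n\to\infty$, to a continuous linear operator on $E_\alpha$, uniformly on bounded subsets of $E_\alpha$. 3.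 $E_\alpha=\operatorname{Ker}(I-\mathsf C)\oplus\overline{(I-\mathsf C)(E_\alpha)}$ (a topological direct sum). 4. $\operatorname{Ker}(I-\mathsf C)=\operatorname{span}\{\mathbf 1\}$, where $\mathbf 1=(1,1,1,\dots)$, and $$\overline{(I-\mathsf C)(E_\alpha)}=\{x\in E_\alpha: x_1=0\}=\overline{\operatorname{span}\{e_n: n\ge 2\}},$$ where $e_n$ is the $n$-th canonical unit vector and closures are taken in $E_\alpha$. -/

import Mathlib

open Filter Topology

noncomputable section

/-! Scalar sequences are functions `ℕ → ℂ`; the entry with index `n` here is the entry with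
index `n + 1` in the usual one-based numbering. -/

/-- `c₀(v)`: the sequences `x` such that `v n * x n → 0`. -/
def WeightedC0 (v : ℕ → ℝ) : Submodule ℂ (ℕ → ℂ) where
  carrier := {x | Tendsto (fun n => (v n : ℂ) * x n) atTop (𝓝 0)}
  zero_mem' := by simp
  add_mem' := by
    intro x y hx hy
    simpa [mul_add] using Tendsto.add hx hy
  smul_mem' := by
    intro c x hx
    simpa [mul_left_comm] using Tendsto.const_mul c hx

theorem WeightedC0.bddAbove (v : ℕ → ℝ) (x : WeightedC0 v) :
    BddAbove (Set.range fun n => |v n| * ‖(x : ℕ → ℂ) n‖) := by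
  have h : Tendsto (fun n => (v n : ℂ) * (x : ℕ → ℂ) n) atTop (𝓝 0) := x.2
  simpa using h.norm.bddAbove_range

/-- The weighted supremum (semi)norm `sup_n |v n| * |x n|` on `c₀(v)`. For strictly positive
weights this is the norm of the Banach space `c₀(v)`. -/
def WeightedC0.supNorm (v : ℕ → ℝ) : Seminorm ℂ (WeightedC0 v) :=
  Seminorm.of (fun x => ⨆ n, |v n| * ‖(x : ℕ → ℂ) n‖)
    (fun x y => by
      refine ciSup_le fun n => ?_
      have hx := le_ciSup (WeightedC0.bddAbove v x) n
      have hy := le_ciSup (WeightedC0.bddAbove v y) n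
      calc |v n| * ‖((x + y : WeightedC0 v) : ℕ → ℂ) n‖
          ≤ |v n| * (‖(x : ℕ → ℂ) n‖ + ‖(y : ℕ → ℂ) n‖) :=
            mul_le_mul_of_nonneg_left (norm_add_le _ _) (abs_nonneg _)
        _ = |v n| * ‖(x : ℕ → ℂ) n‖ + |v n| * ‖(y : ℕ → ℂ) n‖ := mul_add _ _ _
        _ ≤ _ := add_le_add hx hy)
    (fun c x => by
      rw [Real.mul_iSup_of_nonneg (norm_nonneg c)]
      refine iSup_congr fun n => ?_
      simp [mul_left_comm])

theorem continuous_of_le_seminorm {V : Type*} [AddCommGroup V] [Module ℂ V] (p : Seminorm ℂ V)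
    (f : V →ₗ[ℂ] ℂ) (c : ℝ) (h : ∀ x, ‖f x‖ ≤ c * p x) :
    @Continuous _ _ p.toSeminormedAddCommGroup.toUniformSpace.toTopologicalSpace _ f := by
  let := p.toSeminormedAddCommGroup
  exact AddMonoidHomClass.continuous_of_bound f c h

/-- The norm topology of `c₀(v)`. -/
abbrev WeightedC0.normTopology (v : ℕ → ℝ) : TopologicalSpace (WeightedC0 v) :=
  (WeightedC0.supNorm v).toSeminormedAddCommGroup.toUniformSpace.toTopologicalSpace

/-- The weights `v_k(n) = s_k ^ (-α_n)`. -/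
def dualWeight (α s : ℕ → ℝ) (k n : ℕ) : ℝ := s k ^ (-α n)

/-- The underlying vector space of `E_α`: the sum of the spaces `c₀(v_k)` inside `ℂ^ℕ`. If `α` is
positive and `s` is increasing, these spaces increase with `k` and the sum is their union, see
`dualPowerSeriesSubmodule_mem_iff`. -/
def dualPowerSeriesSubmodule (α s : ℕ → ℝ) : Submodule ℂ (ℕ → ℂ) :=
  ⨆ k, WeightedC0 (dualWeight α s k)

theorem dualPowerSeriesSubmodule_mem_iff {α s : ℕ → ℝ} (hα : ∀ n, 0 < α n)
    (hs : ∀ k, 1 < s k) (hs' : StrictMono s) (x : ℕ → ℂ) :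
    x ∈ dualPowerSeriesSubmodule α s ↔ ∃ k, x ∈ WeightedC0 (dualWeight α s k) := by
  refine Submodule.mem_iSup_of_directed _ (Monotone.directed_le ?_)
  intro k l hkl x hx
  have hx : Tendsto (fun n => (dualWeight α s k n : ℂ) * x n) atTop (𝓝 0) := hx
  refine squeeze_zero_norm (fun n => ?_) (tendsto_zero_iff_norm_tendsto_zero.1 hx)
  have hk : 0 < s k := one_pos.trans (hs k)
  have hl : 0 < s l := one_pos.trans (hs l)
  simp only [norm_mul, Complex.norm_real, Real.norm_eq_abs, dualWeight]
  refine mul_le_mul_of_nonneg_right ?_ (norm_nonneg _)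
  rw [abs_of_pos (Real.rpow_pos_of_pos hl _), abs_of_pos (Real.rpow_pos_of_pos hk _)]
  exact Real.rpow_le_rpow_of_nonpos hk (hs'.monotone hkl) (neg_nonpos.2 (hα n).le)

/-- The space `E_α = ind_k c₀(v_k)`. This is a type of its own, so that it does not
inherit the topology of `ℂ^ℕ`. -/
def DualPowerSeriesSpace (α s : ℕ → ℝ) : Type := dualPowerSeriesSubmodule α s

namespace DualPowerSeriesSpace

instance (α s : ℕ → ℝ) : AddCommGroup (DualPowerSeriesSpace α s) :=
  inferInstanceAs (AddCommGroup (dualPowerSeriesSubmodule α s))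

instance (α s : ℕ → ℝ) : Module ℂ (DualPowerSeriesSpace α s) :=
  inferInstanceAs (Module ℂ (dualPowerSeriesSubmodule α s))

/-- The inclusion of `E_α` into the space of all sequences. -/
def toSeq (α s : ℕ → ℝ) : DualPowerSeriesSpace α s →ₗ[ℂ] (ℕ → ℂ) :=
  (dualPowerSeriesSubmodule α s).subtype

/-- The natural inclusion of the step `c₀(v_k)` into `E_α`. -/
def ofStep (α s : ℕ → ℝ) (k : ℕ) :
    WeightedC0 (dualWeight α s k) →ₗ[ℂ] DualPowerSeriesSpace α s :=
  Submodule.inclusion (le_iSup (fun k => WeightedC0 (dualWeight α s k)) k)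

/-- The locally convex inductive limit topology: the finest locally convex vector space topology
for which all inclusions `c₀(v_k) → E_α` are continuous. It is Hausdorff, see
`DualPowerSeriesSpace.t2Space`, so it is also the finest locally convex Hausdorff one. -/
instance (α s : ℕ → ℝ) : TopologicalSpace (DualPowerSeriesSpace α s) :=
  sInf {t | @IsTopologicalAddGroup (DualPowerSeriesSpace α s) t _ ∧
    @ContinuousSMul ℂ (DualPowerSeriesSpace α s) _ _ t ∧
    @LocallyConvexSpace ℝ (DualPowerSeriesSpace α s) _ _ _ _ t ∧
    ∀ k, @Continuous _ _ (WeightedC0.normTopology (dualWeight α s k)) t (ofStep α s k)}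

instance (α s : ℕ → ℝ) : IsTopologicalAddGroup (DualPowerSeriesSpace α s) :=
  topologicalAddGroup_sInf fun _ h => h.1

instance (α s : ℕ → ℝ) : ContinuousSMul ℂ (DualPowerSeriesSpace α s) :=
  continuousSMul_sInf fun _ h => h.2.1

instance (α s : ℕ → ℝ) : LocallyConvexSpace ℝ (DualPowerSeriesSpace α s) :=
  LocallyConvexSpace.sInf fun _ h => h.2.2.1

theorem continuous_toSeq {α s : ℕ → ℝ} (hs : ∀ k, 1 < s k) : Continuous (toSeq α s) := by
  rw [continuous_iff_le_induced]
  refine sInf_le ⟨topologicalAddGroup_induced _, continuousSMul_induced _,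
    LocallyConvexSpace.induced ((toSeq α s).restrictScalars ℝ), fun k => ?_⟩
  refine (@continuous_induced_rng _ _ _ _ _ (_) _).2 ?_
  refine (@continuous_pi_iff _ _ _ (_) _ _).2 fun n => ?_
  have hpos : 0 < dualWeight α s k n := Real.rpow_pos_of_pos (one_pos.trans (hs k)) _
  refine continuous_of_le_seminorm (WeightedC0.supNorm (dualWeight α s k))
    ((LinearMap.proj n).comp (WeightedC0 (dualWeight α s k)).subtype)
    (dualWeight α s k n)⁻¹ fun x => ?_
  have h : |dualWeight α s k n| * ‖(x : ℕ → ℂ) n‖ ≤ WeightedC0.supNorm (dualWeight α s k) x :=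
    le_ciSup (WeightedC0.bddAbove (dualWeight α s k) x) n
  rw [abs_of_pos hpos] at h
  rw [inv_mul_eq_div, le_div_iff₀ hpos, mul_comm]
  exact h

theorem t2Space {α s : ℕ → ℝ} (hs : ∀ k, 1 < s k) : T2Space (DualPowerSeriesSpace α s) :=
  T2Space.of_injective_continuous (f := toSeq α s) Subtype.val_injective (continuous_toSeq hs)

/-- The canonical unit vector, with entry `1` at `n` and `0` elsewhere, as an element of `E_α`. -/
def unitVector (α s : ℕ → ℝ) (n : ℕ) : DualPowerSeriesSpace α s :=
  ofStep α s 0 ⟨Pi.single n 1, by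
    refine tendsto_const_nhds.congr' ?_
    filter_upwards [eventually_gt_atTop n] with m hm
    simp [hm.ne']⟩

end DualPowerSeriesSpace

/-- The Cesàro operator `x ↦ (x₁, (x₁ + x₂) / 2, …, (x₁ + ⋯ + xₙ) / n, …)` on all sequences. -/
def cesaro : (ℕ → ℂ) →ₗ[ℂ] (ℕ → ℂ) where
  toFun x n := (∑ i ∈ Finset.range (n + 1), x i) / ((n : ℂ) + 1)
  map_add' x y := by
    funext n
    simp [Finset.sum_add_distrib, add_div]
  map_smul' c x := by
    funext n
    simp [← Finset.mul_sum, mul_div_assoc]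

/-- `T` is power bounded: the set of its powers `T, T², T³, …` is equicontinuous. -/
def IsPowerBounded {X : Type*} [AddCommGroup X] [Module ℂ X] [TopologicalSpace X]
    [IsTopologicalAddGroup X] (T : X →L[ℂ] X) : Prop :=
  letI : UniformSpace X := IsTopologicalAddGroup.rightUniformSpace X
  Equicontinuous fun (m : ℕ) (x : X) => (T ^ (m + 1)) x

/-- The Cesàro means `T_[n] = (1 / n) ∑_{m = 1}^n T^m` of an operator. -/
def cesaroMean {X : Type*} [AddCommGroup X] [Module ℂ X] [TopologicalSpace X]
    [IsTopologicalAddGroup X] [ContinuousSMul ℂ X] (T : X →L[ℂ] X) (n : ℕ) : X →L[ℂ] X :=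
  (1 / (n : ℂ)) • ∑ m ∈ Finset.Icc 1 n, T ^ m

/-- `T` is uniformly mean ergodic: its Cesàro means converge in the space of continuous linear
operators with the topology of uniform convergence on bounded sets (Mathlib's default topology
on `X →L[ℂ] X`). -/
def IsUniformlyMeanErgodic {X : Type*} [AddCommGroup X] [Module ℂ X] [TopologicalSpace X]
    [IsTopologicalAddGroup X] [ContinuousSMul ℂ X] (T : X →L[ℂ] X) : Prop :=
  ∃ P : X →L[ℂ] X, Tendsto (cesaroMean T) atTop (𝓝 P)

end

section Polynormable

open scoped ComplexOrder in
/-- The topology of a complex space which is locally convex over `ℝ` is generated by seminorms. -/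
theorem LocallyConvexSpace.polynormableSpace_complex (V : Type*) [AddCommGroup V] [Module ℂ V]
    [TopologicalSpace V] [IsTopologicalAddGroup V] [ContinuousSMul ℂ V] [LocallyConvexSpace ℝ V] :
    PolynormableSpace ℂ V := by
  have : ContinuousSMul ℝ V := IsScalarTower.continuousSMul ℂ
  have : LocallyConvexSpace ℂ V := by
    rw [locallyConvexSpace_iff_exists_convex_subset_zero]
    intro U hU
    obtain ⟨S, hS, hc, hSU⟩ := (locallyConvexSpace_iff_exists_convex_subset_zero ℝ V).1
      inferInstance U hU
    exact ⟨S, hS, convex_of_nonneg_surjective_algebraMap _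
      (fun _ hz => RCLike.nonneg_iff_exists_ofReal.mp (Set.mem_Ici.1 hz)) hc, hSU⟩
  exact LocallyConvexSpace.toPolynormableSpace

theorem tendsto_zero_iff_seminorm {V ι : Type*} [AddCommGroup V] [Module ℂ V] [TopologicalSpace V]
    [PolynormableSpace ℂ V] {l : Filter ι} {u : ι → V} :
    Tendsto u l (𝓝 0) ↔ ∀ p : Seminorm ℂ V, Continuous p → Tendsto (fun i => p (u i)) l (𝓝 0) := by
  rw [(PolynormableSpace.withSeminorms ℂ V).tendsto_nhds u 0]
  simp only [sub_zero, Subtype.forall]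
  refine forall₂_congr fun p _ => ?_
  rw [Metric.tendsto_nhds]
  simp [abs_of_nonneg]

/-- In a locally convex space, the arithmetic means of a convergent sequence have the same limit. -/
theorem Filter.Tendsto.arithmeticMean {V : Type*} [AddCommGroup V] [Module ℂ V]
    [TopologicalSpace V] [IsTopologicalAddGroup V] [PolynormableSpace ℂ V] {u : ℕ → V} {l : V}
    (h : Tendsto u atTop (𝓝 l)) :
    Tendsto (fun n : ℕ => (1 / (n : ℂ)) • ∑ m ∈ Finset.Icc 1 n, u m) atTop (𝓝 l) := by
  rw [← tendsto_sub_nhds_zero_iff] at h ⊢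
  rw [tendsto_zero_iff_seminorm] at h ⊢
  intro p hp
  have h1 := ((tendsto_add_atTop_iff_nat 1).2 (h p hp)).cesaro
  refine squeeze_zero' (.of_forall fun n => apply_nonneg p _) ?_ h1
  filter_upwards [eventually_gt_atTop 0] with n hn
  have hn' : (n : ℂ) ≠ 0 := by exact_mod_cast hn.ne'
  have e : (1 / (n : ℂ)) • ∑ m ∈ Finset.Icc 1 n, u m - l =
      (1 / (n : ℂ)) • ∑ m ∈ Finset.range n, (u (m + 1) - l) := by
    rw [Finset.sum_sub_distrib, Finset.sum_const, Finset.card_range, smul_sub,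
      ← Nat.cast_smul_eq_nsmul ℂ, smul_smul, one_div_mul_cancel hn', one_smul,
      Finset.range_eq_Ico, Finset.sum_Ico_add' u 0 n 1]
    rfl
  rw [e, map_smul_eq_mul]
  simp only [one_div, norm_inv, Complex.norm_natCast]
  exact mul_le_mul_of_nonneg_left
    (Finset.le_sum_of_subadditive p (map_zero p).le (map_add_le_add p) _ _) (by positivity)

/-- A linear map into a locally convex space is continuous as soon as its composition with every
continuous seminorm is. -/
theorem LinearMap.continuous_of_seminorm_comp {V W : Type*} [AddCommGroup V] [Module ℂ V]
    [TopologicalSpace V] [IsTopologicalAddGroup V] [AddCommGroup W] [Module ℂ W]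
    [TopologicalSpace W] [PolynormableSpace ℂ W]
    (f : V →ₗ[ℂ] W) (h : ∀ p : Seminorm ℂ W, Continuous p → Continuous (p.comp f)) :
    Continuous f :=
  WithSeminorms.continuous_of_continuous_comp (PolynormableSpace.withSeminorms ℂ W) f
    fun p => h p.1 p.2

theorem ContinuousLinearMap.tendsto_of_seminorm {V W ι : Type*} [AddCommGroup V] [Module ℂ V]
    [TopologicalSpace V] [AddCommGroup W] [Module ℂ W]
    [TopologicalSpace W] [IsTopologicalAddGroup W] [ContinuousSMul ℂ W] [PolynormableSpace ℂ W]
    {l : Filter ι} {T : ι → V →L[ℂ] W} {S : V →L[ℂ] W}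
    (h : ∀ B : Set V, Bornology.IsVonNBounded ℂ B → ∀ p : Seminorm ℂ W, Continuous p →
      ∀ ε > 0, ∀ᶠ i in l, ∀ x ∈ B, p (T i x - S x) < ε) :
    Tendsto T l (𝓝 S) := by
  rw [← tendsto_sub_nhds_zero_iff, ContinuousLinearMap.nhds_zero_eq]
  simp only [tendsto_iInf, tendsto_principal]
  intro B hB U hU
  obtain ⟨F, r, hr, hF⟩ := ((PolynormableSpace.withSeminorms ℂ W).mem_nhds_iff 0 U).1 hU
  have hev : ∀ᶠ i in l, ∀ p ∈ F, ∀ x ∈ B, p.1 (T i x - S x) < r :=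
    (Filter.eventually_all_finset F).2 fun p _ => h B hB p.1 p.2 r hr
  filter_upwards [hev] with i hi x hx
  refine hF ?_
  rw [Seminorm.mem_ball, sub_zero]
  exact Seminorm.finset_sup_apply_lt hr fun p hp => hi p hp x hx

end Polynormable

theorem dualWeight_pos {α s : ℕ → ℝ} (hs : ∀ k, 1 < s k) (k n : ℕ) : 0 < dualWeight α s k n :=
  Real.rpow_pos_of_pos (one_pos.trans (hs k)) _

theorem dualWeight_le_one {α s : ℕ → ℝ} (hα : ∀ n, 0 < α n) (hs : ∀ k, 1 < s k) (k n : ℕ) :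
    dualWeight α s k n ≤ 1 :=
  Real.rpow_le_one_of_one_le_of_nonpos (hs k).le (neg_nonpos.2 (hα n).le)

theorem dualWeight_antitone {α s : ℕ → ℝ} (hα : StrictMono α) (hs : ∀ k, 1 < s k) (k : ℕ) :
    Antitone (dualWeight α s k) := fun _ _ h =>
  Real.rpow_le_rpow_of_exponent_le (hs k).le (neg_le_neg (hα.monotone h))

theorem dualWeight_antitone_step {α s : ℕ → ℝ} (hα : ∀ n, 0 < α n) (hs : ∀ k, 1 < s k)
    (hs' : StrictMono s) (n : ℕ) : Antitone fun k => dualWeight α s k n := fun _ _ h =>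
  Real.rpow_le_rpow_of_nonpos (one_pos.trans (hs _)) (hs'.monotone h) (neg_nonpos.2 (hα n).le)

theorem tendsto_dualWeight_ratio {α s : ℕ → ℝ} (hα : Tendsto α atTop atTop) (hs : ∀ k, 1 < s k)
    (hs' : StrictMono s) (k : ℕ) :
    Tendsto (fun n => dualWeight α s (k + 1) n / dualWeight α s k n) atTop (𝓝 0) := by
  have h0 : 0 < s k := one_pos.trans (hs k)
  have h1 : 0 < s (k + 1) := one_pos.trans (hs (k + 1))
  have hlt : s k / s (k + 1) < 1 := (div_lt_one h1).2 (hs' k.lt_succ_self)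
  refine ((tendsto_rpow_atTop_of_base_lt_one _ (by linarith [div_pos h0 h1]) hlt).comp hα).congr
    fun n => ?_
  simp only [Function.comp, dualWeight]
  rw [Real.div_rpow h0.le h1.le, Real.rpow_neg h0.le, Real.rpow_neg h1.le]
  field_simp

namespace DualPowerSeriesSpace

/-- The sequence `x` lies in the ball of radius `M` of the weighted `ℓ∞` space with weight `v_k`. -/
def IsStepBounded (α s : ℕ → ℝ) (k : ℕ) (M : ℝ) (x : ℕ → ℂ) : Prop :=
  ∀ n, dualWeight α s k n * ‖x n‖ ≤ M

variable {α s : ℕ → ℝ}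

theorem IsStepBounded.nonneg (hs : ∀ k, 1 < s k) {k : ℕ} {M : ℝ} {x : ℕ → ℂ}
    (h : IsStepBounded α s k M x) : 0 ≤ M :=
  (mul_nonneg (dualWeight_pos hs k 0).le (norm_nonneg _)).trans (h 0)

theorem IsStepBounded.mono (hα : ∀ n, 0 < α n) (hs : ∀ k, 1 < s k) (hs' : StrictMono s)
    {k l : ℕ} (hkl : k ≤ l) {M : ℝ} {x : ℕ → ℂ}
    (h : IsStepBounded α s k M x) : IsStepBounded α s l M x := fun n =>
  (mul_le_mul_of_nonneg_right (dualWeight_antitone_step hα hs hs' n hkl) (norm_nonneg _)).trans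
    (h n)

theorem IsStepBounded.succ_le (hs : ∀ k, 1 < s k) {k : ℕ} {M : ℝ} {x : ℕ → ℂ}
    (h : IsStepBounded α s k M x) (n : ℕ) :
    dualWeight α s (k + 1) n * ‖x n‖ ≤ dualWeight α s (k + 1) n / dualWeight α s k n * M := by
  have h0 := dualWeight_pos (α := α) hs k n
  have h1 := dualWeight_pos (α := α) hs (k + 1) n
  calc dualWeight α s (k + 1) n * ‖x n‖
      = dualWeight α s (k + 1) n / dualWeight α s k n * (dualWeight α s k n * ‖x n‖) := by
        field_simp
    _ ≤ _ := mul_le_mul_of_nonneg_left (h n) (by positivity)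

theorem IsStepBounded.mem_weightedC0 (hα : Tendsto α atTop atTop) (hs : ∀ k, 1 < s k)
    (hs' : StrictMono s) {k : ℕ} {M : ℝ} {x : ℕ → ℂ} (h : IsStepBounded α s k M x) :
    x ∈ WeightedC0 (dualWeight α s (k + 1)) := by
  refine squeeze_zero_norm (fun n => ?_)
    (by simpa using (tendsto_dualWeight_ratio hα hs hs' k).mul_const M)
  rw [norm_mul, Complex.norm_real, Real.norm_of_nonneg (dualWeight_pos hs _ n).le]
  exact h.succ_le hs n

theorem mem_submodule_iff_isStepBounded (hα : ∀ n, 0 < α n) (hα' : Tendsto α atTop atTop)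
    (hs : ∀ k, 1 < s k) (hs' : StrictMono s) (x : ℕ → ℂ) :
    x ∈ dualPowerSeriesSubmodule α s ↔ ∃ k M, IsStepBounded α s k M x := by
  rw [dualPowerSeriesSubmodule_mem_iff hα hs hs']
  constructor
  · rintro ⟨k, hk⟩
    obtain ⟨M, hM⟩ := WeightedC0.bddAbove (dualWeight α s k) ⟨x, hk⟩
    refine ⟨k, M, fun n => ?_⟩
    have : |dualWeight α s k n| * ‖x n‖ ≤ M := hM ⟨n, rfl⟩
    rwa [abs_of_pos (dualWeight_pos hs k n)] at this
  · rintro ⟨k, M, h⟩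
    exact ⟨k + 1, h.mem_weightedC0 hα' hs hs'⟩

theorem exists_isStepBounded (hα : ∀ n, 0 < α n) (hα' : Tendsto α atTop atTop)
    (hs : ∀ k, 1 < s k) (hs' : StrictMono s) (x : DualPowerSeriesSpace α s) :
    ∃ k M, IsStepBounded α s k M (toSeq α s x) :=
  (mem_submodule_iff_isStepBounded hα hα' hs hs' _).1 x.2

theorem continuous_ofStep (k : ℕ) :
    @Continuous _ _ (WeightedC0.normTopology (dualWeight α s k)) _ (ofStep α s k) :=
  continuous_sInf_rng.2 fun _ h => h.2.2.2 k

instance : PolynormableSpace ℂ (DualPowerSeriesSpace α s) :=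
  LocallyConvexSpace.polynormableSpace_complex _

theorem continuous_of_le_isStepBounded (hs : ∀ k, 1 < s k)
    (p : Seminorm ℂ (DualPowerSeriesSpace α s))
    (h : ∀ k, ∃ c, ∀ x M, IsStepBounded α s k M (toSeq α s x) → p x ≤ c * M) :
    Continuous p := by
  let t : TopologicalSpace (DualPowerSeriesSpace α s) := inferInstance
  let i₁ : SeminormedAddCommGroup (DualPowerSeriesSpace α s) := p.toSeminormedAddCommGroup
  let i₂ : NormedSpace ℂ (DualPowerSeriesSpace α s) :=
    { norm_smul_le := fun a x => (map_smul_eq_mul p a x).le }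
  have hle : t ≤
      i₁.toUniformSpace.toTopologicalSpace := by
    refine sInf_le ⟨inferInstance, inferInstance, NormedSpace.toLocallyConvexSpace, fun k => ?_⟩
    obtain ⟨c, hc⟩ := h k
    let _ := (WeightedC0.supNorm (dualWeight α s k)).toSeminormedAddCommGroup
    refine AddMonoidHomClass.continuous_of_bound (ofStep α s k) c fun x => ?_
    refine hc _ _ fun n => ?_
    have := le_ciSup (WeightedC0.bddAbove (dualWeight α s k) x) n
    rwa [abs_of_pos (dualWeight_pos hs k n)] at this
  have hp : @Continuous _ _ i₁.toUniformSpace.toTopologicalSpace _ p := continuous_norm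
  exact continuous_le_dom hle hp

theorem exists_le_of_isStepBounded (hα : ∀ n, 0 < α n) (hα' : Tendsto α atTop atTop)
    (hs : ∀ k, 1 < s k) (hs' : StrictMono s) {p : Seminorm ℂ (DualPowerSeriesSpace α s)}
    (hp : Continuous p) (k : ℕ) :
    ∃ c > 0, ∀ x M, IsStepBounded α s k M (toSeq α s x) → p x ≤ c * M := by
  let i₁ := (WeightedC0.supNorm (dualWeight α s (k + 1))).toSeminormedAddCommGroup
  let i₂ : NormedSpace ℂ (WeightedC0 (dualWeight α s (k + 1))) :=
    { norm_smul_le := fun a x =>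
        (map_smul_eq_mul (WeightedC0.supNorm (dualWeight α s (k + 1))) a x).le }
  obtain ⟨c, hc, h⟩ := Seminorm.bound_of_continuous_normedSpace (p.comp (ofStep α s (k + 1)))
    (@Continuous.comp _ _ _ (WeightedC0.normTopology _) _ _ (ofStep α s (k + 1)) p hp (continuous_ofStep (k + 1)))
  refine ⟨c, hc, fun x M hx => (h ⟨_, hx.mem_weightedC0 hα' hs hs'⟩).trans ?_⟩
  refine mul_le_mul_of_nonneg_left (ciSup_le fun n => ?_) hc.le
  rw [abs_of_pos (dualWeight_pos hs _ n)]
  exact hx.mono hα hs hs' k.le_succ n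

theorem exists_continuous_seminorm_ge {ι : Type*} (hα : ∀ n, 0 < α n)
    (hα' : Tendsto α atTop atTop) (hs : ∀ k, 1 < s k) (hs' : StrictMono s)
    (p : ι → Seminorm ℂ (DualPowerSeriesSpace α s))
    (h : ∀ k, ∃ c, ∀ i x M, IsStepBounded α s k M (toSeq α s x) → p i x ≤ c * M) :
    ∃ q : Seminorm ℂ (DualPowerSeriesSpace α s), Continuous q ∧ ∀ i, p i ≤ q := by
  rcases isEmpty_or_nonempty ι with hι | hι
  · exact ⟨0, continuous_const, fun i => hι.elim i⟩
  have hbdd : BddAbove (Set.range p) := by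
    rw [Seminorm.bddAbove_range_iff]
    intro x
    obtain ⟨k, M, hx⟩ := exists_isStepBounded hα hα' hs hs' x
    obtain ⟨c, hc⟩ := h k
    exact ⟨c * M, by rintro _ ⟨i, rfl⟩; exact hc i x M hx⟩
  refine ⟨⨆ i, p i, continuous_of_le_isStepBounded hs _ fun k => ?_, le_ciSup hbdd⟩
  obtain ⟨c, hc⟩ := h k
  refine ⟨c, fun x M hx => ?_⟩
  rw [Seminorm.iSup_apply hbdd]
  exact ciSup_le fun i => hc i x M hx

theorem tendsto_zero_of_isStepBounded {ι : Type*} (hα : ∀ n, 0 < α n)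
    (hα' : Tendsto α atTop atTop) (hs : ∀ k, 1 < s k) (hs' : StrictMono s) {l : Filter ι}
    {u : ι → DualPowerSeriesSpace α s} (k : ℕ)
    (h : ∀ ε > 0, ∀ᶠ i in l, IsStepBounded α s k ε (toSeq α s (u i))) :
    Tendsto u l (𝓝 0) := by
  rw [tendsto_zero_iff_seminorm]
  intro p hp
  obtain ⟨c, hc, hpc⟩ := exists_le_of_isStepBounded hα hα' hs hs' hp k
  rw [Metric.tendsto_nhds]
  intro ε hε
  filter_upwards [h (ε / (2 * c)) (by positivity)] with i hi
  have := hpc _ _ hi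
  rw [Real.dist_0_eq_abs, abs_of_nonneg (apply_nonneg _ _)]
  refine this.trans_lt ?_
  field_simp
  linarith

/-- The bounded subsets of `E_α` are bounded in one of the steps. -/
theorem exists_isStepBounded_of_isVonNBounded (hα : ∀ n, 0 < α n) (hα' : Tendsto α atTop atTop)
    (hs : ∀ k, 1 < s k) (hs' : StrictMono s) {B : Set (DualPowerSeriesSpace α s)}
    (hB : Bornology.IsVonNBounded ℂ B) :
    ∃ k M, ∀ x ∈ B, IsStepBounded α s k M (toSeq α s x) := by
  by_contra! hcon
  simp only [IsStepBounded, not_forall, not_le] at hcon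
  choose x hxB n hn using fun k : ℕ => hcon k k
  let p (k : ℕ) : Seminorm ℂ (DualPowerSeriesSpace α s) :=
    (dualWeight α s k (n k)).toNNReal •
      (normSeminorm ℂ ℂ).comp ((LinearMap.proj (n k)).comp (toSeq α s))
  have hp (k : ℕ) (y : DualPowerSeriesSpace α s) :
      p k y = dualWeight α s k (n k) * ‖toSeq α s y (n k)‖ := by
    simp [p, NNReal.smul_def, (dualWeight_pos hs k (n k)).le]
  obtain ⟨q, hq, hpq⟩ := exists_continuous_seminorm_ge hα hα' hs hs' p fun j => by
    refine ⟨1 + ∑ k ∈ Finset.range j, dualWeight α s k (n k) / dualWeight α s j (n k),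
      fun k y M hy => ?_⟩
    have hM := hy.nonneg hs
    have hpos (k) : 0 ≤ dualWeight α s k (n k) / dualWeight α s j (n k) :=
      (div_pos (dualWeight_pos hs _ _) (dualWeight_pos hs _ _)).le
    have hsum : 0 ≤ ∑ k ∈ Finset.range j, dualWeight α s k (n k) / dualWeight α s j (n k) :=
      Finset.sum_nonneg fun k _ => hpos k
    rw [hp]
    rcases le_or_gt j k with hjk | hjk
    · exact (hy.mono hα hs hs' hjk (n k)).trans
        (le_mul_of_one_le_left hM (le_add_of_nonneg_right hsum))
    · have h0 := dualWeight_pos (α := α) hs j (n k)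
      calc dualWeight α s k (n k) * ‖toSeq α s y (n k)‖
          = dualWeight α s k (n k) / dualWeight α s j (n k) *
            (dualWeight α s j (n k) * ‖toSeq α s y (n k)‖) := by field_simp
        _ ≤ dualWeight α s k (n k) / dualWeight α s j (n k) * M :=
            mul_le_mul_of_nonneg_left (hy (n k)) (hpos k)
        _ ≤ _ := mul_le_mul_of_nonneg_right ((Finset.single_le_sum (fun k _ => hpos k)
            (Finset.mem_range.2 hjk)).trans (le_add_of_nonneg_left zero_le_one)) hM
  obtain ⟨r, -, hr⟩ := ((PolynormableSpace.withSeminorms ℂ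
    (DualPowerSeriesSpace α s)).isVonNBounded_iff_seminorm_bounded).1 hB ⟨q, hq⟩
  obtain ⟨k, hk⟩ := exists_nat_gt r
  have h1 := hpq k (x k)
  rw [hp] at h1
  exact absurd (hr _ (hxB k)) (not_lt.2 ((hk.trans (hn k)).le.trans h1))

end DualPowerSeriesSpace

theorem norm_cesaro_le (x : ℕ → ℂ) (n : ℕ) :
    ‖cesaro x n‖ ≤ (∑ i ∈ Finset.range (n + 1), ‖x i‖) / (n + 1) := by
  have h : ‖(n : ℂ) + 1‖ = n + 1 := by
    exact_mod_cast Complex.norm_natCast (n + 1)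
  change ‖(∑ i ∈ Finset.range (n + 1), x i) / ((n : ℂ) + 1)‖ ≤ _
  rw [norm_div, h]
  gcongr
  exact norm_sum_le _ _

theorem cesaro_apply_zero (x : ℕ → ℂ) : cesaro x 0 = x 0 := by
  simp [cesaro]

theorem cesaro_one : cesaro 1 = 1 := by
  funext n
  have : (n : ℂ) + 1 ≠ 0 := Nat.cast_add_one_ne_zero n
  simp [cesaro, this]

theorem eq_const_of_cesaro_eq {x : ℕ → ℂ} (h : cesaro x = x) (n : ℕ) : x n = x 0 := by
  induction n using Nat.strong_induction_on with
  | _ n ih =>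
    rcases Nat.eq_zero_or_pos n with rfl | hn
    · rfl
    have h1 : (∑ i ∈ Finset.range (n + 1), x i) / ((n : ℂ) + 1) = x n := congrFun h n
    rw [div_eq_iff (Nat.cast_add_one_ne_zero n), Finset.sum_range_succ,
      Finset.sum_congr rfl fun i hi => ih i (Finset.mem_range.1 hi)] at h1
    simp only [Finset.sum_const, Finset.card_range, nsmul_eq_mul] at h1
    have hn' : (n : ℂ) ≠ 0 := by exact_mod_cast hn.ne'
    exact (mul_left_cancel₀ hn' (by linear_combination h1)).symm

theorem norm_cesaro_le_of_apply_zero {x : ℕ → ℂ} (h0 : x 0 = 0) {A : ℝ} {N : ℕ}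
    (hA : ∀ i ≤ N, ‖x i‖ ≤ A) {n : ℕ} (hn : n ≤ N) :
    ‖cesaro x n‖ ≤ (N : ℝ) / (N + 1) * A := by
  have hA0 : 0 ≤ A := (norm_nonneg _).trans (hA 0 N.zero_le)
  refine (norm_cesaro_le x n).trans ?_
  have h1 : ∑ i ∈ Finset.range (n + 1), ‖x i‖ ≤ n * A := by
    rw [Finset.sum_range_succ', h0, norm_zero, add_zero]
    refine (Finset.sum_le_card_nsmul _ _ A fun i hi => hA _ ?_).trans (by simp)
    have := Finset.mem_range.1 hi
    omega
  have h2 : (n : ℝ) ≤ N := by exact_mod_cast hn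
  rw [div_mul_eq_mul_div, div_le_div_iff₀ (by positivity) (by positivity)]
  calc (∑ i ∈ Finset.range (n + 1), ‖x i‖) * ((N : ℝ) + 1) ≤ n * A * (N + 1) := by gcongr
    _ ≤ N * A * (n + 1) := by nlinarith

theorem cesaro_pow_apply_zero (x : ℕ → ℂ) (m : ℕ) : (cesaro ^ m) x 0 = x 0 := by
  induction m with
  | zero => rfl
  | succ m ih => rw [pow_succ', Module.End.mul_apply, cesaro_apply_zero, ih]

theorem norm_cesaro_pow_le_of_apply_zero {x : ℕ → ℂ} (h0 : x 0 = 0) {A : ℝ} {N : ℕ}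
    (hA : ∀ i ≤ N, ‖x i‖ ≤ A) (m : ℕ) {n : ℕ} (hn : n ≤ N) :
    ‖(cesaro ^ m) x n‖ ≤ ((N : ℝ) / (N + 1)) ^ m * A := by
  induction m generalizing n with
  | zero => simpa using hA n hn
  | succ m ih =>
    rw [pow_succ', Module.End.mul_apply, pow_succ', mul_assoc]
    exact norm_cesaro_le_of_apply_zero (by rw [cesaro_pow_apply_zero, h0]) (fun i hi => ih hi) hn

namespace DualPowerSeriesSpace

variable {α s : ℕ → ℝ}

theorem IsStepBounded.cesaro (hα : StrictMono α) (hs : ∀ k, 1 < s k) {k : ℕ} {M : ℝ}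
    {x : ℕ → ℂ} (h : IsStepBounded α s k M x) : IsStepBounded α s k M (cesaro x) := by
  intro n
  have h0 := dualWeight_pos (α := α) hs k n
  refine (mul_le_mul_of_nonneg_left (norm_cesaro_le x n) h0.le).trans ?_
  rw [← mul_div_assoc, Finset.mul_sum, div_le_iff₀ (by positivity)]
  refine (Finset.sum_le_card_nsmul _ _ M fun i hi => ?_).trans (by simp [mul_comm])
  refine (mul_le_mul_of_nonneg_right (dualWeight_antitone hα hs k ?_) (norm_nonneg _)).trans (h i)
  exact Nat.lt_succ_iff.1 (Finset.mem_range.1 hi)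

theorem IsStepBounded.cesaro_pow (hα : StrictMono α) (hs : ∀ k, 1 < s k) {k : ℕ} {M : ℝ}
    {x : ℕ → ℂ} (h : IsStepBounded α s k M x) (m : ℕ) :
    IsStepBounded α s k M ((_root_.cesaro ^ m) x) := by
  induction m with
  | zero => exact h
  | succ m ih =>
    rw [pow_succ', Module.End.mul_apply]
    exact ih.cesaro hα hs

theorem isStepBounded_one (hα : ∀ n, 0 < α n) (hs : ∀ k, 1 < s k) :
    IsStepBounded α s 0 1 (1 : ℕ → ℂ) := fun n => by
  simpa using dualWeight_le_one hα hs 0 n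

theorem IsStepBounded.sub_const (hα : StrictMono α) (hs : ∀ k, 1 < s k) {k : ℕ} {M : ℝ}
    {x : ℕ → ℂ} (h : IsStepBounded α s k M x) :
    IsStepBounded α s k (2 * M) (x - x 0 • (1 : ℕ → ℂ)) := by
  intro n
  have h1 : ‖x n - x 0‖ ≤ ‖x n‖ + ‖x 0‖ := norm_sub_le _ _
  have h2 := (mul_le_mul_of_nonneg_right (dualWeight_antitone hα hs k n.zero_le)
    (norm_nonneg (x 0))).trans (h 0)
  have h3 := mul_le_mul_of_nonneg_left h1 (dualWeight_pos (α := α) hs k n).le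
  have h4 := h n
  simp only [Pi.sub_apply, Pi.smul_apply, Pi.one_apply, smul_eq_mul, mul_one]
  linarith

theorem eventually_dualWeight_ratio_mul_le (hα : Tendsto α atTop atTop) (hs : ∀ k, 1 < s k)
    (hs' : StrictMono s) (k : ℕ) (M : ℝ) {ε : ℝ} (hε : 0 < ε) :
    ∀ᶠ n in atTop, dualWeight α s (k + 1) n / dualWeight α s k n * M ≤ ε := by
  have h := (tendsto_dualWeight_ratio hα hs hs' k).mul_const M
  rw [zero_mul] at h
  exact (h.eventually_lt_const hε).mono fun _ h => h.le

/-- On each step, the powers of the Cesàro operator tend to `0` uniformly on the bounded sets of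
sequences with vanishing first entry, for the norm of the next step. -/
theorem eventually_isStepBounded_cesaro_pow (hα : ∀ n, 0 < α n) (hα_mono : StrictMono α)
    (hα' : Tendsto α atTop atTop) (hs : ∀ k, 1 < s k) (hs' : StrictMono s) (k : ℕ) (M : ℝ)
    {ε : ℝ} (hε : 0 < ε) :
    ∀ᶠ m in atTop, ∀ x : ℕ → ℂ, x 0 = 0 → IsStepBounded α s k M x →
      IsStepBounded α s (k + 1) ε ((cesaro ^ m) x) := by
  obtain ⟨N, hN⟩ := eventually_atTop.1 (eventually_dualWeight_ratio_mul_le hα' hs hs' k M hε)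
  have hw := dualWeight_pos (α := α) hs k N
  have hθ : (N : ℝ) / (N + 1) < 1 := (div_lt_one (by positivity)).2 (by linarith)
  have hlim := (tendsto_pow_atTop_nhds_zero_of_lt_one (by positivity) hθ).mul_const
    (M / dualWeight α s k N)
  rw [zero_mul] at hlim
  filter_upwards [hlim.eventually_lt_const hε] with m hm x h0 hx n
  rcases le_total N n with hn | hn
  · exact ((hx.cesaro_pow hα_mono hs m).succ_le hs n).trans (hN n hn)
  · refine (mul_le_of_le_one_left (norm_nonneg _) (dualWeight_le_one hα hs _ _)).trans
      ((norm_cesaro_pow_le_of_apply_zero h0 (fun i hi => ?_) m hn).trans hm.le)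
    rw [le_div_iff₀' hw]
    exact (mul_le_mul_of_nonneg_right (dualWeight_antitone hα_mono hs k hi)
      (norm_nonneg _)).trans (hx i)

theorem continuous_coord (hs : ∀ k, 1 < s k) (n : ℕ) : Continuous fun x => toSeq α s x n :=
  (continuous_apply n).comp (continuous_toSeq hs)

theorem toSeq_unitVector (n : ℕ) : toSeq α s (unitVector α s n) = Pi.single n 1 := rfl

theorem mem_closure_span_unitVector (hα : ∀ n, 0 < α n)
    (hα' : Tendsto α atTop atTop) (hs : ∀ k, 1 < s k) (hs' : StrictMono s)
    {x : DualPowerSeriesSpace α s} (h0 : toSeq α s x 0 = 0) :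
    x ∈ (Submodule.span ℂ (unitVector α s '' {n | 1 ≤ n})).topologicalClosure := by
  obtain ⟨k, M, hx⟩ := exists_isStepBounded hα hα' hs hs' x
  let t (N : ℕ) := ∑ i ∈ Finset.Ico 1 N, toSeq α s x i • unitVector α s i
  have ht (N n : ℕ) : toSeq α s (t N - x) n = if n < N then 0 else - toSeq α s x n := by
    simp only [t, map_sub, map_sum, map_smul, toSeq_unitVector, Pi.sub_apply, Finset.sum_apply,
      Pi.smul_apply, Pi.single_apply, smul_eq_mul, mul_ite, mul_one, mul_zero,
      Finset.sum_ite_eq, Finset.mem_Ico]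
    rcases Nat.eq_zero_or_pos n with rfl | hn
    · simp [h0]
    · by_cases hN : n < N
      · simp [hN, Nat.succ_le_iff.2 hn]
      · simp [hN]
  have hlim : Tendsto t atTop (𝓝 x) := by
    rw [← tendsto_sub_nhds_zero_iff]
    refine tendsto_zero_of_isStepBounded hα hα' hs hs' (k + 1) fun ε hε => ?_
    obtain ⟨N, hN⟩ := eventually_atTop.1 (eventually_dualWeight_ratio_mul_le hα' hs hs' k M hε)
    filter_upwards [eventually_ge_atTop N] with m hm n
    rw [ht]
    split_ifs with hn
    · simpa using hε.le
    · rw [norm_neg]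
      exact (hx.succ_le hs n).trans (hN n (hm.trans (not_lt.1 hn)))
  refine mem_closure_of_tendsto hlim (.of_forall fun N => ?_)
  refine Submodule.sum_mem _ fun i hi => Submodule.smul_mem _ _ (Submodule.subset_span ?_)
  exact ⟨i, (Finset.mem_Ico.1 hi).1, rfl⟩

/-- The Cesàro operator on `E_α`. -/
noncomputable def cesaroCLM (hα : ∀ n, 0 < α n) (hα_mono : StrictMono α)
    (hα' : Tendsto α atTop atTop) (hs : ∀ k, 1 < s k) (hs' : StrictMono s) :
    DualPowerSeriesSpace α s →L[ℂ] DualPowerSeriesSpace α s where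
  toLinearMap := cesaro.restrict (p := dualPowerSeriesSubmodule α s)
    (q := dualPowerSeriesSubmodule α s) fun x hx => by
      rw [mem_submodule_iff_isStepBounded hα hα' hs hs'] at hx ⊢
      obtain ⟨k, M, h⟩ := hx
      exact ⟨k, M, h.cesaro hα_mono hs⟩
  cont := LinearMap.continuous_of_seminorm_comp (V := DualPowerSeriesSpace α s)
      (W := DualPowerSeriesSpace α s) _ fun p hp =>
    continuous_of_le_isStepBounded hs _ fun k => by
      obtain ⟨c, -, hc⟩ := exists_le_of_isStepBounded hα hα' hs hs' hp k
      exact ⟨c, fun x M hx => hc _ M (hx.cesaro hα_mono hs)⟩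

section cesaroCLM

variable (hα : ∀ n, 0 < α n) (hα_mono : StrictMono α)
    (hα' : Tendsto α atTop atTop) (hs : ∀ k, 1 < s k) (hs' : StrictMono s)

theorem toSeq_cesaroCLM (x : DualPowerSeriesSpace α s) :
    toSeq α s (cesaroCLM hα hα_mono hα' hs hs' x) = cesaro (toSeq α s x) := rfl

theorem toSeq_cesaroCLM_pow (m : ℕ) (x : DualPowerSeriesSpace α s) :
    toSeq α s ((cesaroCLM hα hα_mono hα' hs hs' ^ m) x) = (cesaro ^ m) (toSeq α s x) := by
  induction m with
  | zero => rfl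
  | succ m ih =>
    rw [pow_succ', pow_succ', Module.End.mul_apply, ← ih]
    rfl

theorem isPowerBounded_cesaroCLM : IsPowerBounded (cesaroCLM hα hα_mono hα' hs hs') := by
  let _ : UniformSpace (DualPowerSeriesSpace α s) := IsTopologicalAddGroup.rightUniformSpace _
  have : IsUniformAddGroup (DualPowerSeriesSpace α s) := isUniformAddGroup_of_addCommGroup
  refine (((PolynormableSpace.withSeminorms ℂ (DualPowerSeriesSpace α s)).equicontinuous_TFAE
    fun m : ℕ => (cesaroCLM hα hα_mono hα' hs hs' ^ (m + 1)).toLinearMap).out 3 1).1 fun p => ?_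
  refine exists_continuous_seminorm_ge hα hα' hs hs' _ fun k => ?_
  obtain ⟨c, -, hc⟩ := exists_le_of_isStepBounded hα hα' hs hs' p.2 k
  refine ⟨c, fun m x M hx => hc _ M ?_⟩
  rw [ContinuousLinearMap.coe_coe, toSeq_cesaroCLM_pow]
  exact hx.cesaro_pow hα_mono hs _

/-- The constant sequence `1` as an element of `E_α`. -/
def one : DualPowerSeriesSpace α s :=
  ⟨1, (mem_submodule_iff_isStepBounded hα hα' hs hs' _).2 ⟨0, 1, isStepBounded_one hα hs⟩⟩

/-- The projection `x ↦ (x₁, x₁, …)` of `E_α` onto the constant sequences. -/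
noncomputable def constProj : DualPowerSeriesSpace α s →L[ℂ] DualPowerSeriesSpace α s :=
  ContinuousLinearMap.smulRight
    (⟨(LinearMap.proj 0).comp (toSeq α s), continuous_coord hs 0⟩ :
      DualPowerSeriesSpace α s →L[ℂ] ℂ) (one hα hα' hs hs')

theorem toSeq_one : toSeq α s (one hα hα' hs hs') = 1 := rfl

theorem constProj_apply (x : DualPowerSeriesSpace α s) :
    constProj hα hα' hs hs' x = toSeq α s x 0 • one hα hα' hs hs' := rfl

theorem cesaroCLM_one : cesaroCLM hα hα_mono hα' hs hs' (one hα hα' hs hs') =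
    one hα hα' hs hs' :=
  Subtype.val_injective cesaro_one

theorem tendsto_cesaroCLM_pow :
    Tendsto (fun m => cesaroCLM hα hα_mono hα' hs hs' ^ m) atTop
      (𝓝 (constProj hα hα' hs hs')) := by
  refine ContinuousLinearMap.tendsto_of_seminorm fun B hB p hp ε hε => ?_
  obtain ⟨k, M, hB⟩ := exists_isStepBounded_of_isVonNBounded hα hα' hs hs' hB
  obtain ⟨c, hc, hpc⟩ := exists_le_of_isStepBounded hα hα' hs hs' hp (k + 1)
  have hε' : 0 < ε / (2 * c) := by positivity
  filter_upwards [eventually_isStepBounded_cesaro_pow hα hα_mono hα' hs hs' k (2 * M) hε']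
    with m hm x hx
  have h1 := hm _ (by simp) ((hB x hx).sub_const hα_mono hs)
  have hfix : (cesaro ^ m) (1 : ℕ → ℂ) = 1 := by
    rw [Module.End.pow_apply]
    exact Function.iterate_fixed cesaro_one m
  have h2 : toSeq α s ((cesaroCLM hα hα_mono hα' hs hs' ^ m) x - constProj hα hα' hs hs' x) =
      (cesaro ^ m) (toSeq α s x - toSeq α s x 0 • (1 : ℕ → ℂ)) := by
    rw [map_sub, map_sub, map_smul, hfix, toSeq_cesaroCLM_pow, constProj_apply, map_smul,
      toSeq_one]
  rw [← h2] at h1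
  refine (hpc _ _ h1).trans_lt ?_
  field_simp
  linarith

theorem isUniformlyMeanErgodic_cesaroCLM :
    IsUniformlyMeanErgodic (cesaroCLM hα hα_mono hα' hs hs') :=
  have : ContinuousSMul ℝ (DualPowerSeriesSpace α s) := IsScalarTower.continuousSMul ℂ
  have := LocallyConvexSpace.polynormableSpace_complex
    (DualPowerSeriesSpace α s →L[ℂ] DualPowerSeriesSpace α s)
  ⟨_, (tendsto_cesaroCLM_pow hα hα_mono hα' hs hs').arithmeticMean⟩

theorem mem_ker_one_sub_cesaroCLM {x : DualPowerSeriesSpace α s} :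
    x ∈ LinearMap.ker (1 - cesaroCLM hα hα_mono hα' hs hs').toLinearMap ↔
      x = toSeq α s x 0 • one hα hα' hs hs' := by
  rw [LinearMap.mem_ker]
  change x - cesaroCLM hα hα_mono hα' hs hs' x = 0 ↔ _
  rw [sub_eq_zero]
  constructor
  · intro h
    refine Subtype.val_injective (funext fun n => ?_)
    have := eq_const_of_cesaro_eq (congrArg (toSeq α s) h).symm n
    change toSeq α s x n = toSeq α s x 0 • (1 : ℂ)
    exact this.trans (mul_one _).symm
  · intro h
    rw [h, map_smul, cesaroCLM_one]

theorem ker_one_sub_cesaroCLM : LinearMap.ker (1 - cesaroCLM hα hα_mono hα' hs hs').toLinearMap =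
    LinearMap.range (constProj hα hα' hs hs').toLinearMap := by
  ext x
  rw [mem_ker_one_sub_cesaroCLM, LinearMap.mem_range]
  constructor
  · exact fun h => ⟨x, h.symm⟩
  · rintro ⟨y, rfl⟩
    simp [constProj_apply, toSeq_one]

theorem mem_closure_range_one_sub_cesaroCLM {x : DualPowerSeriesSpace α s} :
    x ∈ (LinearMap.range
      (1 - cesaroCLM hα hα_mono hα' hs hs').toLinearMap).topologicalClosure ↔
      toSeq α s x 0 = 0 := by
  set T := cesaroCLM hα hα_mono hα' hs hs' with hT
  constructor
  · refine fun hx => closure_minimal ?_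
      (isClosed_eq (continuous_coord hs 0) continuous_const) hx
    rintro _ ⟨y, rfl⟩
    change toSeq α s (y - T y) 0 = 0
    rw [map_sub, toSeq_cesaroCLM, Pi.sub_apply, cesaro_apply_zero, sub_self]
  · intro h0
    have h1 : Tendsto (fun m => x - (T ^ m) x) atTop (𝓝 x) := by
      have h2 := ((continuous_eval_const x).tendsto _).comp
        (tendsto_cesaroCLM_pow hα hα_mono hα' hs hs')
      rw [constProj_apply, h0, zero_smul] at h2
      simpa using h2.const_sub x
    refine mem_closure_of_tendsto h1 (.of_forall fun m => ?_)
    refine ⟨(∑ i ∈ Finset.range m, T ^ i) x, ?_⟩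
    exact DFunLike.congr_fun (mul_neg_geom_sum T m) x

theorem closure_range_one_sub_cesaroCLM :
    (LinearMap.range (1 - cesaroCLM hα hα_mono hα' hs hs').toLinearMap).topologicalClosure =
      LinearMap.ker (constProj hα hα' hs hs').toLinearMap := by
  ext x
  rw [mem_closure_range_one_sub_cesaroCLM, LinearMap.mem_ker, ContinuousLinearMap.coe_coe,
    constProj_apply]
  refine ⟨fun h => by rw [h, zero_smul], fun h => ?_⟩
  simpa [toSeq_one] using congrFun (congrArg (toSeq α s) h) 0

theorem isIdempotentElem_constProj : IsIdempotentElem (constProj hα hα' hs hs') := by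
  ext x
  simp [constProj_apply, toSeq_one]

end cesaroCLM

end DualPowerSeriesSpace

theorem proposition4p1 (α s : ℕ → ℝ)
    (hα_pos : ∀ n, 0 < α n) (hα_mono : StrictMono α) (hα_lim : Tendsto α atTop atTop)
    (hs_one : ∀ k, 1 < s k) (hs_mono : StrictMono s) (hs_lim : Tendsto s atTop atTop) :
    ∃ C : DualPowerSeriesSpace α s →L[ℂ] DualPowerSeriesSpace α s,
      (∀ x, DualPowerSeriesSpace.toSeq α s (C x) = cesaro (DualPowerSeriesSpace.toSeq α s x)) ∧
      IsPowerBounded C ∧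
      IsUniformlyMeanErgodic C ∧
      Submodule.IsTopCompl (LinearMap.ker (1 - C).toLinearMap)
        (LinearMap.range (1 - C).toLinearMap).topologicalClosure ∧
      (LinearMap.ker (1 - C).toLinearMap).map (DualPowerSeriesSpace.toSeq α s) =
        Submodule.span ℂ {(1 : ℕ → ℂ)} ∧
      ((LinearMap.range (1 - C).toLinearMap).topologicalClosure :
          Set (DualPowerSeriesSpace α s)) =
        {x | DualPowerSeriesSpace.toSeq α s x 0 = 0} ∧
      (LinearMap.range (1 - C).toLinearMap).topologicalClosure =
        (Submodule.span ℂ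
          (DualPowerSeriesSpace.unitVector α s '' {n | 1 ≤ n})).topologicalClosure := by
  open DualPowerSeriesSpace in
  refine ⟨cesaroCLM hα_pos hα_mono hα_lim hs_one hs_mono, fun x => rfl,
    isPowerBounded_cesaroCLM _ _ _ _ _, isUniformlyMeanErgodic_cesaroCLM .., ?_, ?_, ?_, ?_⟩
  · rw [ker_one_sub_cesaroCLM, closure_range_one_sub_cesaroCLM]
    exact ContinuousLinearMap.IsIdempotentElem.isTopCompl
      (isIdempotentElem_constProj hα_pos hα_lim hs_one hs_mono)
  · ext x
    rw [Submodule.mem_map, Submodule.mem_span_singleton]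
    constructor
    · rintro ⟨y, hy, rfl⟩
      rw [mem_ker_one_sub_cesaroCLM] at hy
      exact ⟨toSeq α s y 0, (congrArg (toSeq α s) hy).symm⟩
    · rintro ⟨a, rfl⟩
      refine ⟨a • one hα_pos hα_lim hs_one hs_mono, ?_, rfl⟩
      rw [mem_ker_one_sub_cesaroCLM]
      simp [toSeq_one]
  · ext x
    exact mem_closure_range_one_sub_cesaroCLM ..
  · refine le_antisymm (fun x hx => ?_) (Submodule.topologicalClosure_minimal _ ?_
      (Submodule.isClosed_topologicalClosure _))
    · rw [mem_closure_range_one_sub_cesaroCLM] at hx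
      exact mem_closure_span_unitVector hα_pos hα_lim hs_one hs_mono hx
    · rw [Submodule.span_le]
      rintro _ ⟨n, hn, rfl⟩
      refine (mem_closure_range_one_sub_cesaroCLM ..).2 ?_
      rw [toSeq_unitVector]
      exact Pi.single_eq_of_ne (Nat.one_le_iff_ne_zero.1 hn).symm 1
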